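/- Let $M$ be a paracompact (Hausdorff) smooth manifold of dimension $n$ and let $A$ be a Weil algebra, i.e. a finite-dimensional commutative unital real algebra with a unique maximal ideal $\mathfrak m$, of codimension $1$ over $\mathbb R$. Let $M^A$ be the Weil bundle of $M$: its points over $x\in M$ are the algebra morphisms $\xi:C^\infty(M)\to A$ with $\xi(f)-f(x)\in\mathfrak m$ for all $f\in C^\infty(M)$, and its smooth structure is given by the charts $x^A:U^A\to A^n$, $\xi\mapsto(\xi(x_1),\dots,\xi(x_n))$, induced by the charts $x=(x_1,\dots,x_n):U\to\mathbb R^n$ of $M$. Let $C^\infty(M^A,A)$ be the $A$-algebra of smooth functions $M^A\to A$; a vector field on $M^A$ is taken to be an $A$-linear derivation $X:C^\infty(M^A,A)\to C^\infty(M^A,A)$ of this algebra. Suppose that $M^A$ is an $A$-Poisson manifold with bracket $\{\,,\}_A$, i.e. $\{\,,\}_A$ makes $C^\infty(M^A,A)$ a Lie algebra over $A$ and $\{\varphi_1\varphi_2,\varphi_3\}_A=\{\varphi_1,\varphi_3\}_A\,\varphi_2+\varphi_1\{\varphi_2,\varphi_3\}_A$ for all $\varphi_1,\varphi_2,\varphi_3\in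 C^\infty(M^A,A)$. Let $\varphi\mapsto\widetilde\tau_\varphi$, $\widetilde\tau_\varphi(\psi)=\{\varphi,\psi\}_A$, be the adjoint representation of $C^\infty(M^A,A)$ by $A$-linear derivations, and let $\widetilde d_A$ be its cohomology operator: for a skew-symmetric $A$-multilinear form $\Omega$ of degree $p$ on $C^\infty(M^A,A)$ with values in $C^\infty(M^A,A)$, $$\widetilde d_A\Omega(\varphi_1,\dots,\varphi_{p+1})=\sum_{i=1}^{p+1}(-1)^{i-1}\,\widetilde\tau_{\varphi_i}\bigl[\Omega(\varphi_1,\dots,\widehat{\varphi_i},\dots,\varphi_{p+1})\bigr]+\sum_{1\le i<j\le p+1}(-1)^{i+j}\,\Omega(\{\varphi_i,\varphi_j\}_A,\varphi_1,\dots,\widehat{\varphi_i},\dots,\widehat{\varphi_j},\dots,\varphi_{p+1}).$$ If a vector field $X$ on $M^A$ is locally hamiltonian, i.e. $\widetilde d_A X=0$ where $X$ is regarded as a form of degree $1$, then $X$ is a derivation of the Poisson $A$-algebra $(C^\infty(M^A,A),\{\,,\}_A)$: besides being $A$-linear with $X(\varphi\psi)=X(\varphi)\psi+\varphi X(\psi)$,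 it satisfies $$X(\{\varphi,\psi\}_A)=\{X(\varphi),\psi\}_A+\{\varphi,X(\psi)\}_A\qquad\text{for all }\varphi,\psi\in C^\infty(M^A,A).$$ -/

import Mathlib

open scoped Manifold ContDiff Topology

/-- A Weil algebra: a finite-dimensional commutative unital real algebra that has a unique maximal
ideal, this ideal being of codimension `1` over `ℝ`. -/
class IsWeilAlgebra (A : Type*) [CommRing A] [Algebra ℝ A] : Prop extends IsLocalRing A where
  finite : Module.Finite ℝ A
  codim : Module.finrank ℝ (A ⧸ IsLocalRing.maximalIdeal A) = 1

/-- The algebra `C^∞(M)` of smooth real functions on an `n`-dimensional manifold. -/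
abbrev SmoothFun (n : ℕ) (M : Type*) [TopologicalSpace M]
    [ChartedSpace (EuclideanSpace ℝ (Fin n)) M] : Type _ :=
  ContMDiffMap (𝓡 n) 𝓘(ℝ, ℝ) M ℝ ∞

/-- The Weil bundle `M^A`: a point is a point `x` of `M` (its origin, so `base` is the projection
`π_M`) with a near point of `x` of kind `A`, that is, a morphism of algebras `ξ : C^∞(M) → A` such
that `ξ f - f x` lies in the maximal ideal for every `f`. -/
@[ext]
structure WeilBundle (n : ℕ) (M : Type*) [TopologicalSpace M]
    [ChartedSpace (EuclideanSpace ℝ (Fin n)) M]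
    (A : Type*) [CommRing A] [Algebra ℝ A] [IsWeilAlgebra A] where
  base : M
  hom : SmoothFun n M →ₐ[ℝ] A
  near : ∀ f : SmoothFun n M, hom f - algebraMap ℝ A (f base) ∈ IsLocalRing.maximalIdeal A

namespace WeilBundle

section Local

variable {n : ℕ} {M : Type*} [TopologicalSpace M] [ChartedSpace (EuclideanSpace ℝ (Fin n)) M]
  {A : Type*} [CommRing A] [Algebra ℝ A] [IsWeilAlgebra A]

open Classical in
/-- The value of a near point on a function that is smooth near its origin only: the value on any
global smooth function with the same germ (`evalGerm_eq` is the independence of the choice). -/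
noncomputable def evalGerm (ξ : WeilBundle n M A) (g : M → ℝ) : A :=
  if h : ∃ f : SmoothFun n M, ∀ᶠ z in 𝓝 ξ.base, f z = g z then ξ.hom h.choose else 0

/-- The chart `x^A = (x_1^A, …, x_n^A) : U^A → A^n` of `M^A` that is induced by a chart
`x : U → ℝ^n` of `M`. -/
noncomputable def chart (e : OpenPartialHomeomorph M (EuclideanSpace ℝ (Fin n)))
    (ξ : WeilBundle n M A) : Fin n → A :=
  fun i => ξ.evalGerm fun z => e z i

/-- The image of the chart `x^A`: the open set of all `v ∈ A^n = ℝ^n ⊕ 𝔪^n` whose real part lies in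
the image of the chart `x`. -/
def chartTarget (A : Type*) [CommRing A] [Algebra ℝ A] [IsWeilAlgebra A]
    (e : OpenPartialHomeomorph M (EuclideanSpace ℝ (Fin n))) : Set (Fin n → A) :=
  {v | ∃ y ∈ e.target, ∀ i, v i - algebraMap ℝ A (y i) ∈ IsLocalRing.maximalIdeal A}

/-- Near points are local: they do not separate functions with the same germ at the origin. -/
theorem hom_eq_of_eventuallyEq [T2Space M] [IsManifold (𝓡 n) ∞ M] (ξ : WeilBundle n M A)
    {f g : SmoothFun n M} (h : ∀ᶠ z in 𝓝 ξ.base, f z = g z) : ξ.hom f = ξ.hom g := by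
  obtain ⟨χ, -, hχ⟩ := (SmoothBumpFunction.nhds_basis_support (I := 𝓡 n) h).mem_iff.1 h
  let c : SmoothFun n M := ⟨χ, χ.contMDiff⟩
  have hc : c * (f - g) = 0 := by
    ext z
    by_cases hz : z ∈ Function.support χ
    · have hz' : f z = g z := hχ hz
      change χ z * (f z - g z) = 0
      rw [hz', sub_self, mul_zero]
    · change χ z * (f z - g z) = 0
      rw [Function.notMem_support.1 hz, zero_mul]
  have hu : IsUnit (ξ.hom c) := by
    have h1 := ξ.near c
    have h2 : c ξ.base = 1 := χ.eq_one
    rw [h2, map_one] at h1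
    by_contra hn
    have h3 : ξ.hom c ∈ IsLocalRing.maximalIdeal A := hn
    have h4 : (1 : A) ∈ IsLocalRing.maximalIdeal A := by
      have := Ideal.sub_mem _ h3 h1
      rwa [sub_sub_cancel] at this
    exact (Ideal.ne_top_iff_one _).1 (IsLocalRing.maximalIdeal.isMaximal A).ne_top h4
  have h0 : ξ.hom c * (ξ.hom f - ξ.hom g) = 0 := by
    rw [← map_sub, ← map_mul, hc, map_zero]
  exact sub_eq_zero.1 (hu.mul_right_eq_zero.1 h0)

theorem evalGerm_eq [T2Space M] [IsManifold (𝓡 n) ∞ M] (ξ : WeilBundle n M A) {g : M → ℝ}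
    (f : SmoothFun n M) (h : ∀ᶠ z in 𝓝 ξ.base, f z = g z) : ξ.evalGerm g = ξ.hom f := by
  have hex : ∃ f : SmoothFun n M, ∀ᶠ z in 𝓝 ξ.base, f z = g z := ⟨f, h⟩
  rw [evalGerm, dif_pos hex]
  apply hom_eq_of_eventuallyEq
  filter_upwards [hex.choose_spec, h] with z h1 h2
  rw [h1, h2]

/-- Every function that is smooth on a neighbourhood of a point has the germ of a global one. -/
theorem exists_smoothFun_eventuallyEq [T2Space M] [IsManifold (𝓡 n) ∞ M]
    {s : Set M} {x : M} (hs : s ∈ 𝓝 x) (hs' : IsOpen s) {g : M → ℝ}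
    (hg : ContMDiffOn (𝓡 n) 𝓘(ℝ, ℝ) ∞ g s) :
    ∃ f : SmoothFun n M, ∀ᶠ z in 𝓝 x, f z = g z := by
  obtain ⟨χ, -, hχ⟩ := (SmoothBumpFunction.nhds_basis_tsupport (I := 𝓡 n) x).mem_iff.1 hs
  refine ⟨⟨fun z => χ z * g z, ?_⟩, ?_⟩
  · refine contMDiff_of_tsupport fun z hz => ?_
    have hz' : z ∈ s := hχ (tsupport_mul_subset_left hz)
    exact χ.contMDiffAt.mul ((hg z hz').contMDiffAt (hs'.mem_nhds hz'))
  · filter_upwards [χ.eventuallyEq_one] with z hz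
    change χ z * g z = g z
    rw [hz]
    simp

/-- In a smooth chart around its origin, a near point has coordinates in the stated image. -/
theorem chart_mem_chartTarget [T2Space M] [IsManifold (𝓡 n) ∞ M]
    {e : OpenPartialHomeomorph M (EuclideanSpace ℝ (Fin n))}
    (he : e ∈ IsManifold.maximalAtlas (𝓡 n) ∞ M)
    (ξ : WeilBundle n M A) (hξ : ξ.base ∈ e.source) : ξ.chart e ∈ chartTarget A e := by
  refine ⟨e ξ.base, e.map_source hξ, fun i => ?_⟩
  have hi : ContMDiffOn (𝓡 n) 𝓘(ℝ, ℝ) ∞ (fun z => e z i) e.source :=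
    (EuclideanSpace.proj (𝕜 := ℝ) i).contMDiff.comp_contMDiffOn (contMDiffOn_of_mem_maximalAtlas he)
  obtain ⟨f, hf⟩ := exists_smoothFun_eventuallyEq (e.open_source.mem_nhds hξ) e.open_source hi
  have h := ξ.near f
  rw [hf.self_of_nhds] at h
  rwa [chart, evalGerm_eq ξ f hf]

end Local

/-- A function `φ : M^A → A` is smooth if it is smooth in the charts `x^A` of `M^A`: for every smooth
chart `x : U → ℝ^n` of `M`, the function `φ ∘ (x^A)⁻¹` (here `F`) is of class `C^∞` on the open set
`x^A(U^A) ⊆ A^n`. The norm of the finite-dimensional space `A` matters through its topology only. -/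
def IsSmooth {n : ℕ} {M : Type*} [TopologicalSpace M] [ChartedSpace (EuclideanSpace ℝ (Fin n)) M]
    [IsManifold (𝓡 n) ∞ M] {A : Type*} [NormedCommRing A] [NormedAlgebra ℝ A] [IsWeilAlgebra A]
    (φ : WeilBundle n M A → A) : Prop :=
  ∀ e ∈ IsManifold.maximalAtlas (𝓡 n) ∞ M, ∃ F : (Fin n → A) → A,
    ContDiffOn ℝ ∞ F (chartTarget A e) ∧
      ∀ ξ : WeilBundle n M A, ξ.base ∈ e.source → φ ξ = F (ξ.chart e)

/-- The `A`-algebra `C^∞(M^A, A)`, with the pointwise operations. -/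
def smoothFunctions (n : ℕ) (M : Type*) [TopologicalSpace M]
    [ChartedSpace (EuclideanSpace ℝ (Fin n)) M] [IsManifold (𝓡 n) ∞ M]
    (A : Type*) [NormedCommRing A] [NormedAlgebra ℝ A] [IsWeilAlgebra A] :
    Subalgebra A (WeilBundle n M A → A) where
  carrier := {φ | IsSmooth φ}
  mul_mem' := by
    intro φ ψ hφ hψ e he
    obtain ⟨F, hF, hF'⟩ := hφ e he
    obtain ⟨G, hG, hG'⟩ := hψ e he
    exact ⟨fun v => F v * G v, hF.mul hG, fun ξ hξ => by
      rw [Pi.mul_apply, hF' ξ hξ, hG' ξ hξ]⟩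
  add_mem' := by
    intro φ ψ hφ hψ e he
    obtain ⟨F, hF, hF'⟩ := hφ e he
    obtain ⟨G, hG, hG'⟩ := hψ e he
    exact ⟨fun v => F v + G v, hF.add hG, fun ξ hξ => by
      rw [Pi.add_apply, hF' ξ hξ, hG' ξ hξ]⟩
  algebraMap_mem' := by
    intro a e _
    exact ⟨fun _ => a, contDiffOn_const, fun _ _ => rfl⟩

end WeilBundle

/-- A structure of Poisson algebra over `A` on a commutative `A`-algebra `C`: a bracket which makes
`C` a Lie algebra over `A` and is a derivation of the product in its first argument. -/
structure PoissonStructure (A C : Type*) [CommRing A] [CommRing C] [Algebra A C] where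
  bracket : C →ₗ[A] C →ₗ[A] C
  bracket_self : ∀ φ, bracket φ φ = 0
  jacobi : ∀ φ ψ χ,
    bracket φ (bracket ψ χ) + bracket ψ (bracket χ φ) + bracket χ (bracket φ ψ) = 0
  leibniz : ∀ φ₁ φ₂ φ₃, bracket (φ₁ * φ₂) φ₃ = bracket φ₁ φ₃ * φ₂ + φ₁ * bracket φ₂ φ₃

namespace PoissonStructure

variable {A C : Type*} [CommRing A] [CommRing C] [Algebra A C] (P : PoissonStructure A C)

theorem bracket_skew (φ ψ : C) : P.bracket φ ψ = -P.bracket ψ φ := by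
  have h := P.bracket_self (φ + ψ)
  simp only [map_add, LinearMap.add_apply, P.bracket_self, zero_add, add_zero] at h
  exact eq_neg_of_add_eq_zero_right h

/-- The adjoint representation `C → Der_A C`, sending `φ` to the derivation
`τ φ : ψ ↦ {φ, ψ}`. -/
def tau (φ : C) : Derivation A C C :=
  Derivation.mk' (P.bracket φ) fun ψ χ => by
    rw [P.bracket_skew φ (ψ * χ), P.leibniz, P.bracket_skew ψ φ, P.bracket_skew χ φ]
    simp only [smul_eq_mul]
    ring

/-- The cohomology operator of the adjoint representation, on skew-symmetric `A`-multilinear forms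
of degree `p` on `C` with values in `C`:
`(d Ω) (φ_0, …, φ_p) = ∑ i, (-1) ^ i τ(φ_i) [Ω (φ_0, …, omit φ_i, …, φ_p)]`
`  + ∑ i < j, (-1) ^ (i + j) Ω ({φ_i, φ_j}, φ_0, …, omit φ_i, …, omit φ_j, …, φ_p)`.
Indices start from `0`; the second sum is empty for `p = 0`. -/
def d : {p : ℕ} → (C [⋀^Fin p]→ₗ[A] C) → (Fin (p + 1) → C) → C
  | 0, Ω, φ => ∑ i : Fin 1, (-1) ^ (i : ℕ) * P.tau (φ i) (Ω (i.removeNth φ))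
  | q + 1, Ω, φ =>
      ∑ i : Fin (q + 2), (-1) ^ (i : ℕ) * P.tau (φ i) (Ω (i.removeNth φ)) +
        ∑ j : Fin (q + 2), ∑ i : Fin (q + 1) with i.castSucc < j,
          (-1) ^ ((i : ℕ) + (j : ℕ)) *
            Ω (Fin.cons (P.bracket (φ i.castSucc) (φ j)) (i.removeNth (j.removeNth φ)))

/-- A vector field, that is, an `A`-linear derivation of `C`, is locally hamiltonian if it is closed
as a form of degree `1` for the cohomology of the adjoint representation. -/
def IsLocallyHamiltonian (X : Derivation A C C) : Prop :=
  P.d (AlternatingMap.ofSubsingleton A C C (0 : Fin 1) X.toLinearMap) = 0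

/-- An `A`-linear map is a derivation of the Poisson `A`-algebra if it is a derivation both of the
product and of the bracket. -/
def IsPoissonDerivation (X : C →ₗ[A] C) : Prop :=
  (∀ φ ψ, X (φ * ψ) = X φ * ψ + φ * X ψ) ∧
    ∀ φ ψ, X (P.bracket φ ψ) = P.bracket (X φ) ψ + P.bracket φ (X ψ)

end PoissonStructure

/-!
For a derivation `X`, viewed as a form of degree `1`, the cohomology operator of the adjoint
representation has three terms:
`(d X) (φ, ψ) = {φ, X ψ} - {ψ, X φ} - X {φ, ψ}`  (`PoissonStructure.d_ofSubsingleton_apply`).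
By skew-symmetry of the bracket, `d X = 0` says exactly that `X` is a derivation of the bracket. The
argument is purely algebraic: it holds for every Poisson `A`-algebra `C`
(`PoissonStructure.IsLocallyHamiltonian.isPoissonDerivation`), in particular for `C^∞(M^A, A)`.
-/

namespace PoissonStructure

variable {A C : Type*} [CommRing A] [CommRing C] [Algebra A C] (P : PoissonStructure A C)

@[simp]
theorem tau_apply (φ ψ : C) : P.tau φ ψ = P.bracket φ ψ := rfl

theorem d_ofSubsingleton_apply (f : C →ₗ[A] C) (φ ψ : C) :
    P.d (AlternatingMap.ofSubsingleton A C C (0 : Fin 1) f) ![φ, ψ] =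
      P.bracket φ (f ψ) - P.bracket ψ (f φ) - f (P.bracket φ ψ) := by
  -- The only pair `i < j` of indices in `{0, 1}` is `(0, 1)`, which carries the sign `-1`.
  simp [d, Fin.sum_univ_two, Finset.sum_filter, Fin.removeNth, sub_eq_add_neg]

variable {P}

theorem IsLocallyHamiltonian.isPoissonDerivation {X : Derivation A C C}
    (hX : P.IsLocallyHamiltonian X) : P.IsPoissonDerivation X.toLinearMap := by
  refine ⟨fun φ ψ => ?_, fun φ ψ => ?_⟩
  · have h := X.leibniz φ ψ
    simp only [smul_eq_mul] at h
    change X (φ * ψ) = X φ * ψ + φ * X ψ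
    rw [h]
    ring
  · have h := congrFun hX ![φ, ψ]
    rw [d_ofSubsingleton_apply, P.bracket_skew ψ] at h
    rw [← sub_eq_zero.1 h]
    abel

end PoissonStructure

theorem mainTheorem4 (n : ℕ) (M : Type*) [TopologicalSpace M] [T2Space M] [ParacompactSpace M]
    [ChartedSpace (EuclideanSpace ℝ (Fin n)) M] [IsManifold (𝓡 n) ∞ M]
    (A : Type*) [NormedCommRing A] [NormedAlgebra ℝ A] [IsWeilAlgebra A]
    (P : PoissonStructure A (WeilBundle.smoothFunctions n M A))
    (X : Derivation A (WeilBundle.smoothFunctions n M A) (WeilBundle.smoothFunctions n M A))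
    (hX : P.IsLocallyHamiltonian X) :
    P.IsPoissonDerivation X.toLinearMap :=
  hX.isPoissonDerivation
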